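/- **Proposition.** Let $M$ be a closed manifold (compact, Hausdorff, without boundary; not necessarily connected) and let $\pi_Q\colon Q\to M$ and $\pi_P\colon P\to M$ be oriented (i.e. principal) circle bundles over $M$, with structure group $\mathbb{S}^1=\mathbb{R}/\mathbb{Z}$ written additively. For an integer $n\ge 1$, a *fiberwise $n$-fold covering* is a continuous map $\phi\colon Q\to P$ with $\pi_P\circ\phi=\pi_Q$ and $\phi(\theta\cdot q)=(n\theta)\cdot\phi(q)$ for all $\theta\in\mathbb{S}^1$, $q\in Q$; then $n$ is called its *number of sheets*. A *fiberwise covering* is a fiberwise $n$-fold covering for some $n\ge 1$. Two fiberwise coverings $\phi_1,\phi_2\colon Q\to P$ are *isomorphic* if there is a homeomorphism $\psi\colon Q\to Q$ with $\phi_1\circ\psi=\phi_2$. If $\phi_1,\phi_2$ are both $n$-fold, there is a unique continuous map $\mathrm{f}_{(\phi_1,\phi_2)}\colon M\to\mathbb{S}^1$ with $\mathrm{f}_{(\phi_1,\phi_2)}(\pi_Q(q))\cdot\phi_1(q)=\phi_2(q)$ for all $q\in Q$, and their *horizontal distance* is $$d(\phi_1,\phi_2)=\mathrm{f}_{(\phi_1,\phi_2)}^*[\mathbb{S}^1]\in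 H^1(M;\mathbb{Z}),$$ where $[\mathbb{S}^1]\in H^1(\mathbb{S}^1;\mathbb{Z})$ is the fundamental class of the standard orientation and $H^1$ is singular cohomology. Two fiberwise coverings $\phi_1,\phi_2\colon Q\to P$ are isomorphic if and only if they have the same number $n$ of sheets and $d(\phi_1,\phi_2)\bmod n=0$ in $H^1(M;\mathbb{Z}/n)$ (equivalently, $d(\phi_1,\phi_2)\in n\cdot H^1(M;\mathbb{Z})$). -/

import Mathlib

/-! ### Singular cohomology in degree one -/

namespace SingularCoh

/-- A singular `k`-simplex of `X`: a continuous map from the standard `k`-simplex to `X`. -/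
abbrev Simplex (k : ℕ) (X : Type*) [TopologicalSpace X] : Type _ :=
  C(stdSimplex ℝ (Fin (k + 1)), X)

/-- Singular `k`-cochains of `X` with coefficients in `A`, as functions on singular simplices
(equivalently, homomorphisms from the free abelian group on singular simplices to `A`). -/
abbrev Cochain (k : ℕ) (X A : Type*) [TopologicalSpace X] : Type _ :=
  Simplex k X → A

/-- The inclusion of the `i`-th face (opposite to the `i`-th vertex) of the standard simplex. -/
noncomputable def face {k : ℕ} (i : Fin (k + 2)) :
    C(stdSimplex ℝ (Fin (k + 1)), stdSimplex ℝ (Fin (k + 2))) :=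
  ⟨stdSimplex.map i.succAbove, stdSimplex.continuous_map i.succAbove⟩

/-- The coboundary `(δ c)(σ) = ∑ i, (-1)^i c(σ ∘ face i)`. -/
noncomputable def coboundary (k : ℕ) (X A : Type*) [TopologicalSpace X] [AddCommGroup A] :
    Cochain k X A →+ Cochain (k + 1) X A where
  toFun c := fun σ => ∑ i : Fin (k + 2), ((-1 : ℤ) ^ (i : ℕ)) • c (σ.comp (face i))
  map_zero' := by
    funext σ
    simp
  map_add' c c' := by
    funext σ
    simp [Finset.sum_add_distrib]

theorem coboundary_zero_apply {X A : Type*} [TopologicalSpace X] [AddCommGroup A]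
    (c : Cochain 0 X A) (σ : Simplex 1 X) :
    coboundary 0 X A c σ = c (σ.comp (face 0)) - c (σ.comp (face 1)) := by
  simp [coboundary, Fin.sum_univ_succ, sub_eq_add_neg]

theorem coboundary_one_apply {X A : Type*} [TopologicalSpace X] [AddCommGroup A]
    (c : Cochain 1 X A) (σ : Simplex 2 X) :
    coboundary 1 X A c σ =
      c (σ.comp (face 0)) - c (σ.comp (face 1)) + c (σ.comp (face 2)) := by
  simp [coboundary, Fin.sum_univ_succ, sub_eq_add_neg]
  abel

/-- `δ ∘ δ = 0` in the lowest degree. -/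
theorem coboundary_coboundary {X A : Type*} [TopologicalSpace X] [AddCommGroup A]
    (c : Cochain 0 X A) : coboundary 1 X A (coboundary 0 X A c) = 0 := by
  have key : ∀ (σ : Simplex 2 X) (i i' : Fin 3) (j j' : Fin 2),
      i.succAbove ∘ j.succAbove = i'.succAbove ∘ j'.succAbove →
      (σ.comp (face i)).comp (face j) = (σ.comp (face i')).comp (face j') := by
    intro σ i i' j j' h
    ext x
    simp only [face, ContinuousMap.comp_apply, ContinuousMap.coe_mk, stdSimplex.map_comp_apply]
    rw [h]
  funext σ
  rw [coboundary_one_apply]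
  simp only [coboundary_zero_apply]
  rw [key σ 0 1 0 0 (by decide), key σ 0 2 1 0 (by decide), key σ 1 2 1 1 (by decide)]
  simp

/-- Singular `1`-cocycles. -/
noncomputable abbrev Z1 (X A : Type*) [TopologicalSpace X] [AddCommGroup A] :
    AddSubgroup (Cochain 1 X A) :=
  (coboundary 1 X A).ker

/-- Singular `1`-coboundaries, as a subgroup of the cocycles. -/
noncomputable abbrev B1 (X A : Type*) [TopologicalSpace X] [AddCommGroup A] :
    AddSubgroup (Z1 X A) :=
  (coboundary 0 X A).range.addSubgroupOf (Z1 X A)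

/-- The first singular cohomology group `H¹(X; A)`. -/
abbrev H1 (X A : Type*) [TopologicalSpace X] [AddCommGroup A] : Type _ :=
  Z1 X A ⧸ B1 X A

/-- Pullback of `1`-cocycles along a continuous map. -/
noncomputable def pullbackZ1 {X Y : Type*} [TopologicalSpace X] [TopologicalSpace Y]
    (A : Type*) [AddCommGroup A] (f : C(X, Y)) : Z1 Y A →+ Z1 X A where
  toFun c := ⟨fun σ => c.1 (f.comp σ), by
    have h := (AddMonoidHom.mem_ker).1 c.2
    rw [AddMonoidHom.mem_ker]
    funext σ
    exact congrFun h (f.comp σ)⟩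
  map_zero' := rfl
  map_add' _ _ := rfl

/-- The map `f^* : H¹(Y; A) → H¹(X; A)` induced by a continuous map `f : X → Y`. -/
noncomputable def pullback {X Y : Type*} [TopologicalSpace X] [TopologicalSpace Y]
    (A : Type*) [AddCommGroup A] (f : C(X, Y)) : H1 Y A →+ H1 X A :=
  QuotientAddGroup.map (B1 Y A) (B1 X A) (pullbackZ1 A f) (by
    rintro c hc
    obtain ⟨b, hb⟩ := AddSubgroup.mem_addSubgroupOf.1 hc
    refine AddSubgroup.mem_comap.2 (AddSubgroup.mem_addSubgroupOf.2 ⟨fun σ => b (f.comp σ), ?_⟩)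
    funext σ
    exact congrFun hb (f.comp σ))

theorem coboundary_map (k : ℕ) (X : Type*) [TopologicalSpace X] {A B : Type*}
    [AddCommGroup A] [AddCommGroup B] (g : A →+ B) (c : Cochain k X A) :
    coboundary k X B (fun σ => g (c σ)) = fun σ => g (coboundary k X A c σ) := by
  funext σ
  simp [coboundary, map_sum]

/-- Change of coefficients on `1`-cocycles. -/
noncomputable def coeffMapZ1 (X : Type*) [TopologicalSpace X] {A B : Type*}
    [AddCommGroup A] [AddCommGroup B] (g : A →+ B) : Z1 X A →+ Z1 X B where
  toFun c := ⟨fun σ => g (c.1 σ), by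
    have h := (AddMonoidHom.mem_ker).1 c.2
    rw [AddMonoidHom.mem_ker, coboundary_map, h]
    funext σ
    simp⟩
  map_zero' := by
    ext σ
    simp
  map_add' c c' := by
    ext σ
    simp

/-- The change-of-coefficients map `H¹(X; A) → H¹(X; B)` induced by `g : A → B`. -/
noncomputable def coeffMap (X : Type*) [TopologicalSpace X] {A B : Type*}
    [AddCommGroup A] [AddCommGroup B] (g : A →+ B) : H1 X A →+ H1 X B :=
  QuotientAddGroup.map (B1 X A) (B1 X B) (coeffMapZ1 X g) (by
    rintro c hc
    obtain ⟨b, hb⟩ := AddSubgroup.mem_addSubgroupOf.1 hc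
    refine AddSubgroup.mem_comap.2 (AddSubgroup.mem_addSubgroupOf.2 ⟨fun σ => g (b σ), ?_⟩)
    rw [coboundary_map, hb]
    rfl)

/-- Reduction modulo `n`, `H¹(X; ℤ) → H¹(X; ℤ/n)`. -/
noncomputable def reduceMod (X : Type*) [TopologicalSpace X] (n : ℕ) :
    H1 X ℤ →+ H1 X (ZMod n) :=
  coeffMap X (Int.castAddHom (ZMod n))

/-- For `n > 0`, an integral class vanishes modulo `n` iff it is `n` times an integral class. -/
theorem reduceMod_eq_zero_iff (X : Type*) [TopologicalSpace X] {n : ℕ} (hn : 0 < n)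
    (d : H1 X ℤ) : reduceMod X n d = 0 ↔ ∃ a : H1 X ℤ, d = n • a := by
  constructor
  · induction d using QuotientAddGroup.induction_on with
    | H c =>
      intro h
      obtain ⟨b, hb⟩ := AddSubgroup.mem_addSubgroupOf.1 ((QuotientAddGroup.eq_zero_iff _).1 h)
      choose b' hb' using fun σ => ZMod.intCast_surjective (b σ)
      have hdvd : ∀ σ, ∃ a : ℤ, c.1 σ - coboundary 0 X ℤ b' σ = n * a := by
        intro σ
        have h1 := congrFun (coboundary_map 0 X (Int.castAddHom (ZMod n)) b') σ
        have h2 : (fun σ => (Int.castAddHom (ZMod n)) (b' σ)) = b := funext hb'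
        rw [h2, hb] at h1
        have h3 : ((c.1 σ : ℤ) : ZMod n) = ((coboundary 0 X ℤ b' σ : ℤ) : ZMod n) := h1
        obtain ⟨a, ha⟩ := (ZMod.intCast_eq_intCast_iff_dvd_sub _ _ n).1 h3.symm
        exact ⟨a, ha⟩
      choose a ha using hdvd
      have hca : c.1 - coboundary 0 X ℤ b' = n • a := by
        funext σ
        simpa using ha σ
      have hmem : a ∈ Z1 X ℤ := by
        rw [AddMonoidHom.mem_ker]
        have h4 : n • coboundary 1 X ℤ a = 0 := by
          rw [← map_nsmul, ← hca, map_sub, coboundary_coboundary, sub_zero]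
          exact (AddMonoidHom.mem_ker).1 c.2
        funext σ
        have h5 : n • coboundary 1 X ℤ a σ = 0 := congrFun h4 σ
        rcases smul_eq_zero.1 h5 with h6 | h6
        · omega
        · exact h6
      refine ⟨QuotientAddGroup.mk ⟨a, hmem⟩, ?_⟩
      rw [← QuotientAddGroup.mk_nsmul, ← sub_eq_zero, ← QuotientAddGroup.mk_sub]
      refine (QuotientAddGroup.eq_zero_iff _).2 (AddSubgroup.mem_addSubgroupOf.2 ⟨b', ?_⟩)
      have h7 : coboundary 0 X ℤ b' = c.1 - n • a := by
        rw [← hca]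
        abel
      rw [h7]
      rfl
  · rintro ⟨a, rfl⟩
    rw [map_nsmul]
    induction reduceMod X n a using QuotientAddGroup.induction_on with
    | H c =>
      rw [← QuotientAddGroup.mk_nsmul]
      have : n • c = 0 := by
        ext σ
        simp
      rw [this]
      rfl

/-! ### The fundamental class of the circle -/

/-- Every singular simplex of `ℝ/ℤ` lifts to `ℝ`. -/
theorem exists_lift {k : ℕ} (σ : Simplex k UnitAddCircle) :
    ∃ τ : C(stdSimplex ℝ (Fin (k + 1)), ℝ), ∀ x, (τ x : UnitAddCircle) = σ x := by
  have : ContractibleSpace (stdSimplex ℝ (Fin (k + 1))) :=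
    (convex_stdSimplex ℝ (Fin (k + 1))).contractibleSpace
      ⟨_, single_mem_stdSimplex ℝ (0 : Fin (k + 1))⟩
  obtain ⟨y, hy⟩ := id_nullhomotopic (stdSimplex ℝ (Fin (k + 1)))
  obtain ⟨F⟩ := hy.symm
  obtain ⟨r, hr⟩ := QuotientAddGroup.mk_surjective (σ y)
  have cov := AddCircle.isCoveringMap_coe (1 : ℝ)
  have H0 : ∀ a, (σ.comp F.toContinuousMap) (0, a) =
      ((ContinuousMap.const (stdSimplex ℝ (Fin (k + 1))) r a : ℝ) : UnitAddCircle) := by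
    intro a
    have h1 : F.toContinuousMap (0, a) = y := F.map_zero_left a
    rw [ContinuousMap.comp_apply, h1]
    exact hr.symm
  refine ⟨(cov.liftHomotopy _ _ H0).comp ⟨fun a => (1, a), by fun_prop⟩, fun x => ?_⟩
  have h2 := congrFun (cov.liftHomotopy_lifts _ _ H0) (1, x)
  have h3 : F.toContinuousMap (1, x) = x := F.map_one_left x
  refine h2.trans ?_
  rw [ContinuousMap.comp_apply, h3]

/-- The chosen lift to `ℝ` of a singular simplex of `ℝ/ℤ`. -/
noncomputable def lift {k : ℕ} (σ : Simplex k UnitAddCircle) :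
    C(stdSimplex ℝ (Fin (k + 1)), ℝ) :=
  (exists_lift σ).choose

theorem coe_lift {k : ℕ} (σ : Simplex k UnitAddCircle) (x : stdSimplex ℝ (Fin (k + 1))) :
    (lift σ x : UnitAddCircle) = σ x :=
  (exists_lift σ).choose_spec x

/-- The winding cochain on `ℝ/ℤ`: the value on a path is `⌊end⌋ - ⌊start⌋` for any lift of the
path to `ℝ`, that is, the signed number of passages through `0`. -/
noncomputable def winding : Cochain 1 UnitAddCircle ℤ :=
  fun σ => ⌊lift σ (stdSimplex.vertex 1)⌋ - ⌊lift σ (stdSimplex.vertex 0)⌋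

/-- The winding cochain may be computed from any lift. -/
theorem winding_eq (σ : Simplex 1 UnitAddCircle) (τ : C(stdSimplex ℝ (Fin 2), ℝ))
    (hτ : ∀ x, (τ x : UnitAddCircle) = σ x) :
    winding σ = ⌊τ (stdSimplex.vertex 1)⌋ - ⌊τ (stdSimplex.vertex 0)⌋ := by
  obtain ⟨m, hm⟩ : ∃ m : ℤ, ∀ x, lift σ x = τ x + m := by
    have hint : ∀ x, ∃ m : ℤ, lift σ x - τ x = m := by
      intro x
      have h : ((lift σ x - τ x : ℝ) : UnitAddCircle) = 0 := by
        rw [AddCircle.coe_sub, coe_lift, hτ, sub_self]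
      obtain ⟨m, hm⟩ := (AddCircle.coe_eq_zero_iff (1 : ℝ)).1 h
      exact ⟨m, by simpa using hm.symm⟩
    choose m hm using hint
    have hcont : Continuous m := by
      rw [Int.isClosedEmbedding_coe_real.isEmbedding.continuous_iff]
      have : ((↑) : ℤ → ℝ) ∘ m = fun x => lift σ x - τ x := funext fun x => (hm x).symm
      rw [this]
      fun_prop
    refine ⟨m (stdSimplex.vertex 0), fun x => ?_⟩
    have h := PreconnectedSpace.constant inferInstance hcont (x := x) (y := stdSimplex.vertex 0)
    rw [← h, ← hm x]
    ring
  simp only [winding, hm, Int.floor_add_intCast]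
  ring

theorem winding_mem_Z1 : winding ∈ Z1 UnitAddCircle ℤ := by
  rw [AddMonoidHom.mem_ker]
  funext σ
  have key : ∀ i : Fin 3, winding (σ.comp (face i)) =
      ⌊lift σ (stdSimplex.vertex (i.succAbove 1))⌋ -
        ⌊lift σ (stdSimplex.vertex (i.succAbove 0))⌋ := by
    intro i
    rw [winding_eq _ ((lift σ).comp (face i)) (fun x => by
      rw [ContinuousMap.comp_apply, ContinuousMap.comp_apply, coe_lift])]
    simp only [face, ContinuousMap.comp_apply, ContinuousMap.coe_mk, stdSimplex.map_vertex]
  rw [coboundary_one_apply, key, key, key]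
  have e1 : (0 : Fin 3).succAbove (1 : Fin 2) = 2 := by decide
  have e2 : (0 : Fin 3).succAbove (0 : Fin 2) = 1 := by decide
  have e3 : (1 : Fin 3).succAbove (1 : Fin 2) = 2 := by decide
  have e4 : (1 : Fin 3).succAbove (0 : Fin 2) = 0 := by decide
  have e5 : (2 : Fin 3).succAbove (1 : Fin 2) = 1 := by decide
  have e6 : (2 : Fin 3).succAbove (0 : Fin 2) = 0 := by decide
  rw [e1, e2, e3, e4, e5, e6]
  simp

/-- The fundamental class `[S¹] ∈ H¹(S¹; ℤ)` of the circle `S¹ = ℝ/ℤ` with its standard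
orientation. -/
noncomputable def fundamentalClass : H1 UnitAddCircle ℤ :=
  QuotientAddGroup.mk ⟨winding, winding_mem_Z1⟩

/-- The fundamental class takes the value `1` on the standard loop `t ↦ t mod 1`. -/
theorem winding_standardLoop :
    winding (⟨fun x => ((x.1 1 : ℝ) : UnitAddCircle), by
      exact (AddCircle.continuous_mk' (1 : ℝ)).comp
        ((continuous_apply 1).comp continuous_subtype_val)⟩ : Simplex 1 UnitAddCircle) = 1 := by
  rw [winding_eq _ ⟨fun x => x.1 1, (continuous_apply 1).comp continuous_subtype_val⟩
    (fun _ => rfl)]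
  simp

end SingularCoh

/-! ### Circle bundles and fiberwise coverings -/

/-- `π : Q → M` is an (oriented, i.e. principal) circle bundle: the circle `ℝ/ℤ` acts on `Q`
preserving the fibers, and `π` is locally trivial by equivariant trivializations
`π⁻¹(U) ≅ U × ℝ/ℤ`. In particular the action on each fiber is simply transitive. -/
structure IsCircleBundle {Q M : Type*} [TopologicalSpace Q] [TopologicalSpace M]
    [AddAction UnitAddCircle Q] (π : Q → M) : Prop where
  proj_vadd : ∀ (θ : UnitAddCircle) (q : Q), π (θ +ᵥ q) = π q
  exists_trivialization : ∀ p : M, ∃ e : Bundle.Trivialization UnitAddCircle π, p ∈ e.baseSet ∧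
    ∀ (θ : UnitAddCircle) (q : Q), π q ∈ e.baseSet → (e (θ +ᵥ q)).2 = θ + (e q).2

/-- `φ : Q → P` is a fiberwise `n`-fold covering: it is continuous, maps the fiber over `p` to the
fiber over `p` for each `p ∈ M`, and on fibers it is the standard `n`-fold covering
`θ ↦ n • θ` of the circle (after choosing base points `q` and `φ q` in the fibers). -/
structure IsNFoldFiberwiseCovering {Q P M : Type*} [TopologicalSpace Q] [TopologicalSpace P]
    [AddAction UnitAddCircle Q] [AddAction UnitAddCircle P] (πQ : Q → M) (πP : P → M)
    (n : ℕ) (φ : Q → P) : Prop where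
  pos : 0 < n
  continuous : Continuous φ
  proj_comp : ∀ q, πP (φ q) = πQ q
  map_vadd : ∀ (θ : UnitAddCircle) (q : Q), φ (θ +ᵥ q) = (n • θ) +ᵥ φ q

/-- `φ : Q → P` is a fiberwise covering: a fiberwise `n`-fold covering for some `n`. -/
def IsFiberwiseCovering {Q P M : Type*} [TopologicalSpace Q] [TopologicalSpace P]
    [AddAction UnitAddCircle Q] [AddAction UnitAddCircle P] (πQ : Q → M) (πP : P → M)
    (φ : Q → P) : Prop :=
  ∃ n : ℕ, IsNFoldFiberwiseCovering πQ πP n φ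

/-- `φ₁, φ₂ : Q → P` are isomorphic as coverings of `P`: there is a homeomorphism `ψ` of `Q` with
`φ₁ ∘ ψ = φ₂`. For fiberwise coverings such a `ψ` automatically preserves the fibers of `Q`. -/
def AreIsomorphicCoverings {Q P : Type*} [TopologicalSpace Q] (φ₁ φ₂ : Q → P) : Prop :=
  ∃ ψ : Q ≃ₜ Q, φ₁ ∘ ψ = φ₂

section HorizontalDistance

/-- For two fiberwise `n`-fold coverings there is a unique map `f : M → S¹` with
`f(p) · φ₁(q) = φ₂(q)` for all `p` and all `q` in the fiber over `p`, and it is continuous. -/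
theorem existsUnique_difference {Q P M : Type*} [TopologicalSpace Q] [TopologicalSpace P]
    [TopologicalSpace M] [AddAction UnitAddCircle Q] [AddAction UnitAddCircle P]
    {πQ : Q → M} {πP : P → M} (hQ : IsCircleBundle πQ) (hP : IsCircleBundle πP)
    {n : ℕ} {φ₁ φ₂ : Q → P} (h₁ : IsNFoldFiberwiseCovering πQ πP n φ₁)
    (h₂ : IsNFoldFiberwiseCovering πQ πP n φ₂) :
    ∃! f : C(M, UnitAddCircle), ∀ q : Q, f (πQ q) +ᵥ φ₁ q = φ₂ q := by
  choose eQ hQmem hQeq using hQ.exists_trivialization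
  choose eP hPmem hPeq using hP.exists_trivialization
  -- a point over `x` in the trivialization of `Q` around `p`
  let s : M → M → Q := fun p x => (eQ p).toOpenPartialHomeomorph.symm (x, 0)
  have hs : ∀ p x, x ∈ (eQ p).baseSet → πQ (s p x) = x := fun p x hx =>
    (eQ p).proj_symm_apply' hx
  have htrans : ∀ p (q q' : P), πP q ∈ (eP p).baseSet → πP q' = πP q →
      ((eP p q').2 - (eP p q).2) +ᵥ q = q' := by
    intro p q q' hq hqq
    have m1 : ((eP p q').2 - (eP p q).2) +ᵥ q ∈ (eP p).source := by
      rw [(eP p).mem_source, hP.proj_vadd]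
      exact hq
    have m2 : q' ∈ (eP p).source := by
      rw [(eP p).mem_source, hqq]
      exact hq
    refine (eP p).injOn m1 m2 (Prod.ext ?_ ?_)
    · exact ((eP p).coe_fst m1).trans ((hP.proj_vadd _ _).trans (hqq.symm.trans ((eP p).coe_fst m2).symm))
    · exact (hPeq p _ _ hq).trans (sub_add_cancel _ _)
  have htransQ : ∀ q q' : Q, πQ q' = πQ q → ∃ θ : UnitAddCircle, θ +ᵥ q = q' := by
    intro q q' hqq
    let p := πQ q
    refine ⟨(eQ p q').2 - (eQ p q).2, ?_⟩
    have hq : πQ q ∈ (eQ p).baseSet := hQmem p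
    have m1 : ((eQ p q').2 - (eQ p q).2) +ᵥ q ∈ (eQ p).source := by
      rw [(eQ p).mem_source, hQ.proj_vadd]
      exact hq
    have m2 : q' ∈ (eQ p).source := by
      rw [(eQ p).mem_source, hqq]
      exact hq
    refine (eQ p).injOn m1 m2 (Prod.ext ?_ ?_)
    · exact ((eQ p).coe_fst m1).trans ((hQ.proj_vadd _ _).trans (hqq.symm.trans ((eQ p).coe_fst m2).symm))
    · exact (hQeq p _ _ hq).trans (sub_add_cancel _ _)
  -- the action on the fibers of `P` is free
  have hfree : ∀ (a b : UnitAddCircle) (q : P), a +ᵥ q = b +ᵥ q → a = b := by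
    intro a b q h
    have h' := congrArg (fun z => (eP (πP q) z).2) h
    simp only [hPeq (πP q) _ _ (hPmem (πP q))] at h'
    exact add_right_cancel h'
  have hloc : ∀ p, ∀ q : Q, πQ q ∈ (eP p).baseSet → ∀ q₀ : Q, πQ q₀ = πQ q →
      ((eP p (φ₂ q₀)).2 - (eP p (φ₁ q₀)).2) +ᵥ φ₁ q = φ₂ q := by
    intro p q hq q₀ hq₀
    obtain ⟨θ, rfl⟩ := htransQ q₀ q hq₀.symm
    rw [h₁.map_vadd, h₂.map_vadd, vadd_vadd, add_comm, ← vadd_vadd]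
    rw [htrans p (φ₁ q₀) (φ₂ q₀) (by rw [h₁.proj_comp, hq₀]; exact hq)
      (by rw [h₁.proj_comp, h₂.proj_comp])]
  let g : M → M → UnitAddCircle := fun p x =>
    (eP p (φ₂ (s p x))).2 - (eP p (φ₁ (s p x))).2
  have hg : ∀ p q, πQ q ∈ (eP p).baseSet → πQ q ∈ (eQ p).baseSet →
      g p (πQ q) +ᵥ φ₁ q = φ₂ q := fun p q hq hq' => hloc p q hq _ (hs p _ hq')
  have hcont : Continuous fun x => g x x := by
    rw [continuous_iff_continuousAt]
    intro p
    have hU : (eP p).baseSet ∩ (eQ p).baseSet ∈ nhds p :=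
      Filter.inter_mem ((eP p).open_baseSet.mem_nhds (hPmem p))
        ((eQ p).open_baseSet.mem_nhds (hQmem p))
    have hsc : ContinuousAt (s p) p := by
      have hmem : ((p, 0) : M × UnitAddCircle) ∈ (eQ p).target := by
        rw [(eQ p).mem_target]
        exact hQmem p
      exact ContinuousAt.comp (f := fun x : M => ((x, 0) : M × UnitAddCircle))
        ((eQ p).toOpenPartialHomeomorph.continuousAt_symm hmem)
        (by fun_prop)
    have hec : ∀ φ : Q → P, IsNFoldFiberwiseCovering πQ πP n φ →
        ContinuousAt (fun x => (eP p (φ (s p x))).2) p := by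
      intro φ hφ
      have hm : φ (s p p) ∈ (eP p).source := by
        rw [(eP p).mem_source, hφ.proj_comp, hs p p (hQmem p)]
        exact hPmem p
      have h1 : ContinuousAt (fun x => φ (s p x)) p :=
        ContinuousAt.comp (f := s p) (g := φ) hφ.continuous.continuousAt hsc
      have h2 : ContinuousAt (fun x => eP p (φ (s p x))) p :=
        ContinuousAt.comp (f := fun x => φ (s p x)) (g := eP p)
          ((eP p).toOpenPartialHomeomorph.continuousAt hm) h1
      exact h2.snd
    have hgp : ContinuousAt (g p) p := (hec φ₂ h₂).sub (hec φ₁ h₁)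
    refine hgp.congr ?_
    filter_upwards [hU] with x hx
    have hx' := hs p x hx.2
    have e1 := hg p (s p x) (by rw [hx']; exact hx.1) (by rw [hx']; exact hx.2)
    have e2 := hg x (s p x) (by rw [hx']; exact hPmem x) (by rw [hx']; exact hQmem x)
    rw [hx'] at e1 e2
    exact hfree _ _ _ (e1.trans e2.symm)
  refine ⟨⟨fun x => g x x, hcont⟩, fun q => hg _ q (hPmem _) (hQmem _), ?_⟩
  intro f hf
  ext x
  have hx' := hs x x (hQmem x)
  have e1 := hf (s x x)
  have e2 := hg x (s x x) (by rw [hx']; exact hPmem x) (by rw [hx']; exact hQmem x)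
  rw [hx'] at e1 e2
  exact hfree _ _ _ (e1.trans e2.symm)

/-- The map `f_(φ₁,φ₂) : M → S¹` with `f_(φ₁,φ₂)(p) · φ₁(q) = φ₂(q)` for `q` in the fiber
over `p`. -/
noncomputable def differenceMap {Q P M : Type*} [TopologicalSpace Q] [TopologicalSpace P]
    [TopologicalSpace M] [AddAction UnitAddCircle Q] [AddAction UnitAddCircle P]
    {πQ : Q → M} {πP : P → M} (hQ : IsCircleBundle πQ) (hP : IsCircleBundle πP)
    {n : ℕ} {φ₁ φ₂ : Q → P} (h₁ : IsNFoldFiberwiseCovering πQ πP n φ₁)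
    (h₂ : IsNFoldFiberwiseCovering πQ πP n φ₂) : C(M, UnitAddCircle) :=
  (existsUnique_difference hQ hP h₁ h₂).choose

theorem differenceMap_vadd {Q P M : Type*} [TopologicalSpace Q] [TopologicalSpace P]
    [TopologicalSpace M] [AddAction UnitAddCircle Q] [AddAction UnitAddCircle P]
    {πQ : Q → M} {πP : P → M} (hQ : IsCircleBundle πQ) (hP : IsCircleBundle πP)
    {n : ℕ} {φ₁ φ₂ : Q → P} (h₁ : IsNFoldFiberwiseCovering πQ πP n φ₁)
    (h₂ : IsNFoldFiberwiseCovering πQ πP n φ₂) (q : Q) :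
    differenceMap hQ hP h₁ h₂ (πQ q) +ᵥ φ₁ q = φ₂ q :=
  (existsUnique_difference hQ hP h₁ h₂).choose_spec.1 q

/-- The horizontal distance `d(φ₁, φ₂) = f_(φ₁,φ₂)^* [S¹] ∈ H¹(M; ℤ)` of two fiberwise `n`-fold
coverings. -/
noncomputable def horizontalDistance {Q P M : Type*} [TopologicalSpace Q] [TopologicalSpace P]
    [TopologicalSpace M] [AddAction UnitAddCircle Q] [AddAction UnitAddCircle P]
    {πQ : Q → M} {πP : P → M} (hQ : IsCircleBundle πQ) (hP : IsCircleBundle πP)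
    {n : ℕ} {φ₁ φ₂ : Q → P} (h₁ : IsNFoldFiberwiseCovering πQ πP n φ₁)
    (h₂ : IsNFoldFiberwiseCovering πQ πP n φ₂) : SingularCoh.H1 M ℤ :=
  SingularCoh.pullback ℤ (differenceMap hQ hP h₁ h₂) SingularCoh.fundamentalClass

end HorizontalDistance

/-!
An isomorphism `ψ` of two fiberwise `n`-fold coverings is automatically equivariant
(`IsNFoldFiberwiseCovering.map_vadd_of_comp_eq`), so it has the form `q ↦ h(π q) · q` for a
continuous `h : M → S¹`. Since `φ₁ (h(π q) · q) = (n h(π q)) · φ₁ q`, such a map intertwines `φ₁`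
and `φ₂` exactly when `n h` is the difference map `f` of the two coverings
(`IsNFoldFiberwiseCovering.areIsomorphicCoverings_iff_exists_nsmul`). The proposition thus says that
`f` is divisible by `n` in `C(M, S¹)` if and only if `f^*[S¹]` vanishes modulo `n`.

If `f = n h`, the class modulo `n` is the coboundary of `x ↦ ⌊n r(x)⌋`, where `r(x)` is any real
representative of `h x`. Conversely, a `0`-cochain `b : M → ℤ` whose coboundary agrees modulo `n`
with the winding cochain of `f` gives the `n`-th part `h(x) = ({r(x)} + b(x)) / n` of `f`, where now
`r(x)` represents `f x`. Locally `f` lifts to a real function `T`, and the condition on `b` makes `h`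
differ from `T / n` by a constant on path connected sets, so `h` is continuous because manifolds are
locally path connected.

The number of sheets is an isomorphism invariant because it is the cardinality of the fibers of the
covering, which are torsors over the `n`-torsion of the circle.
-/

/-! ### Divisibility of circle-valued maps and the fundamental class -/
namespace SingularCoh

theorem comp_face_zero {X : Type*} [TopologicalSpace X] (σ : Simplex 1 X) :
    σ.comp (face 0) = ContinuousMap.const _ (σ (stdSimplex.vertex 1)) := by
  ext x
  obtain rfl : x = stdSimplex.vertex 0 := Subsingleton.elim _ _
  simp [face, stdSimplex.map_vertex]

theorem comp_face_one {X : Type*} [TopologicalSpace X] (σ : Simplex 1 X) :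
    σ.comp (face 1) = ContinuousMap.const _ (σ (stdSimplex.vertex 0)) := by
  ext x
  obtain rfl : x = stdSimplex.vertex 0 := Subsingleton.elim _ _
  simp [face, stdSimplex.map_vertex]

/-- The vanishing of `f^*[S¹]` modulo `n`, with the `0`-cochain regarded as a function on points
and its values lifted to the integers. -/
theorem reduceMod_pullback_fundamentalClass_eq_zero_iff_winding {X : Type*} [TopologicalSpace X]
    (n : ℕ) (f : C(X, UnitAddCircle)) :
    reduceMod X n (pullback ℤ f fundamentalClass) = 0 ↔
      ∃ b : X → ℤ, ∀ σ : Simplex 1 X, ((winding (f.comp σ) : ℤ) : ZMod n) =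
        (b (σ (stdSimplex.vertex 1)) - b (σ (stdSimplex.vertex 0)) : ℤ) := by
  refine (QuotientAddGroup.eq_zero_iff _).trans (AddSubgroup.mem_addSubgroupOf.trans ?_)
  constructor
  · rintro ⟨c, hc⟩
    choose b hb using fun x : X => ZMod.intCast_surjective (c (ContinuousMap.const _ x))
    refine ⟨b, fun σ => ?_⟩
    have h := congrFun hc σ
    rw [coboundary_zero_apply, comp_face_zero, comp_face_one, ← hb, ← hb] at h
    rw [Int.cast_sub]
    exact h.symm
  · rintro ⟨b, hb⟩
    refine ⟨fun σ => b (σ (stdSimplex.vertex 0)), ?_⟩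
    funext σ
    rw [coboundary_zero_apply, comp_face_zero, comp_face_one, ContinuousMap.const_apply,
      ContinuousMap.const_apply, ← Int.cast_sub]
    exact (hb σ).symm

theorem reduceMod_pullback_fundamentalClass_eq_zero {X : Type*} [TopologicalSpace X] {n : ℕ}
    {f h : C(X, UnitAddCircle)} (hf : ∀ x, n • h x = f x) :
    reduceMod X n (pullback ℤ f fundamentalClass) = 0 := by
  rw [reduceMod_pullback_fundamentalClass_eq_zero_iff_winding]
  choose r hr using fun x => QuotientAddGroup.mk_surjective (h x)
  refine ⟨fun x => ⌊n * r x⌋, fun σ => ?_⟩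
  have hτ : ∀ x, ((((n : ℝ) * lift (h.comp σ) x : ℝ)) : UnitAddCircle) = f.comp σ x := by
    intro x
    rw [← nsmul_eq_mul, AddCircle.coe_nsmul, coe_lift]
    exact hf _
  rw [winding_eq _ ⟨fun x => (n : ℝ) * lift (h.comp σ) x, by fun_prop⟩ hτ]
  -- the chosen lift along `σ` and the representative `r` differ by an integer, which changes the
  -- floor of the `n`-fold by a multiple of `n`
  have key : ∀ x, ((⌊(n : ℝ) * lift (h.comp σ) x⌋ : ℤ) : ZMod n) = (⌊n * r (σ x)⌋ : ℤ) := by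
    intro x
    have h1 : ((lift (h.comp σ) x - r (σ x) : ℝ) : UnitAddCircle) = 0 := by
      rw [AddCircle.coe_sub, coe_lift]
      exact sub_eq_zero.2 (hr (σ x)).symm
    obtain ⟨m, hm⟩ := (AddCircle.coe_eq_zero_iff (1 : ℝ)).1 h1
    have h2 : (n : ℝ) * lift (h.comp σ) x = n * r (σ x) + ((n * m : ℤ) : ℝ) := by
      rw [zsmul_one] at hm
      push_cast
      rw [hm]
      ring
    rw [h2, Int.floor_add_intCast]
    simp
  simp [key]

/-- A path, read as a singular `1`-simplex, along which `f` has the lift `T`: its winding number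
depends on the values of `T` at the end points only. -/
theorem winding_comp_of_path {X : Type*} [TopologicalSpace X] (f : C(X, UnitAddCircle))
    {x y : X} (γ : Path x y) {T : X → ℝ} (hT : ContinuousOn T (Set.range γ))
    (hTf : ∀ z ∈ Set.range γ, (T z : UnitAddCircle) = f z) :
    ∃ σ : Simplex 1 X, σ (stdSimplex.vertex 0) = x ∧ σ (stdSimplex.vertex 1) = y ∧
      winding (f.comp σ) = ⌊T y⌋ - ⌊T x⌋ := by
  let e := stdSimplexHomeomorphUnitInterval
  let σ : Simplex 1 X := ⟨fun t => γ (e t), by fun_prop⟩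
  have h0 : σ (stdSimplex.vertex 0) = x := γ.source
  have h1 : σ (stdSimplex.vertex 1) = y := γ.target
  refine ⟨σ, h0, h1, ?_⟩
  rw [winding_eq (f.comp σ) ⟨fun t => T (σ t), hT.comp_continuous σ.continuous
    fun t => Set.mem_range_self (e t)⟩ fun t => hTf _ (Set.mem_range_self (e t))]
  simp only [ContinuousMap.coe_mk, h0, h1]

/-- On a locally path connected space, the vanishing of `f^*[S¹]` modulo `n` suffices to lift `f`
through the `n`-fold covering of the circle. -/
theorem exists_nsmul_eq_of_reduceMod_eq_zero {X : Type*} [TopologicalSpace X]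
    [LocallyPathConnectedSpace X] {n : ℕ} (hn : 0 < n) (f : C(X, UnitAddCircle))
    (hf : reduceMod X n (pullback ℤ f fundamentalClass) = 0) :
    ∃ h : C(X, UnitAddCircle), ∀ x, n • h x = f x := by
  obtain ⟨b, hb⟩ := (reduceMod_pullback_fundamentalClass_eq_zero_iff_winding n f).1 hf
  choose r hr using fun x => QuotientAddGroup.mk_surjective (f x)
  have hn' : (n : ℝ) ≠ 0 := by exact_mod_cast hn.ne'
  let h : X → UnitAddCircle := fun x => ((Int.fract (r x) + b x) / n : ℝ)
  have hh : ∀ x, n • h x = f x := by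
    intro x
    rw [← hr x, ← AddCircle.coe_nsmul, nsmul_eq_mul, mul_div_cancel₀ _ hn', AddCircle.coe_add,
      AddCircle.coe_fract]
    have : ((b x : ℝ) : UnitAddCircle) = 0 := (AddCircle.coe_eq_zero_iff (1 : ℝ)).2 ⟨b x, by simp⟩
    rw [this, add_zero]
  refine ⟨⟨h, continuous_iff_continuousAt.2 fun x => ?_⟩, hh⟩
  -- near `x`, a local section of `ℝ → ℝ/ℤ` gives a real lift `T` of `f`
  obtain ⟨e, hxe, he⟩ := (AddCircle.isCoveringMap_coe (1 : ℝ)).isLocalHomeomorph (r x)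
  have hxt : f x ∈ e.target := by
    rw [← hr x]
    have := e.map_source hxe
    rwa [← he] at this
  have hW : f ⁻¹' e.target ∈ nhds x := f.continuous.continuousAt (e.open_target.mem_nhds hxt)
  obtain ⟨V, ⟨hV, hVc⟩, hVW⟩ := (path_connected_basis x).mem_iff.1 hW
  let T : X → ℝ := fun y => e.symm (f y)
  have hTc : ContinuousOn T V :=
    e.continuousOn_symm.comp f.continuous.continuousOn fun y hy => hVW hy
  have hTf : ∀ y ∈ V, (T y : UnitAddCircle) = f y := by
    intro y hy
    have := e.right_inv (hVW hy)
    rwa [← he] at this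
  have hxV : x ∈ V := mem_of_mem_nhds hV
  -- over `V`, the function `h` is `T / n` plus a constant
  have hhT : ∀ y ∈ V, h y = ((T y / n : ℝ) : UnitAddCircle) + (((b x - ⌊T x⌋) / n : ℝ)) := by
    intro y hy
    obtain ⟨γ, hγ⟩ := hVc.joinedIn x hxV y hy
    have hγV : Set.range γ ⊆ V := Set.range_subset_iff.2 hγ
    obtain ⟨σ, h0, h1, hσ⟩ := winding_comp_of_path f γ (hTc.mono hγV) fun z hz => hTf z (hγV hz)
    have h2 := hb σ
    rw [hσ, h0, h1] at h2
    obtain ⟨k, hk⟩ := (ZMod.intCast_eq_intCast_iff_dvd_sub _ _ n).1 h2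
    obtain ⟨m, hm⟩ : ∃ m : ℤ, r y = T y + m := by
      have h3 : ((r y - T y : ℝ) : UnitAddCircle) = 0 := by
        rw [AddCircle.coe_sub, hTf y hy]
        exact sub_eq_zero.2 (hr y)
      obtain ⟨m, hm⟩ := (AddCircle.coe_eq_zero_iff (1 : ℝ)).1 h3
      rw [zsmul_one] at hm
      exact ⟨m, by rw [hm]; ring⟩
    rw [← AddCircle.coe_add, ← sub_eq_zero, ← AddCircle.coe_sub]
    refine (AddCircle.coe_eq_zero_iff (1 : ℝ)).2 ⟨k, ?_⟩
    have hk' : ((b y : ℝ) - b x) - (⌊T y⌋ - ⌊T x⌋) = n * k := by exact_mod_cast hk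
    rw [zsmul_one, hm, Int.fract_add_intCast, Int.fract]
    field_simp
    linarith
  have hcont : ContinuousAt
      (fun y => ((T y / n : ℝ) : UnitAddCircle) + (((b x - ⌊T x⌋) / n : ℝ))) x :=
    (((AddCircle.continuous_mk' (1 : ℝ)).continuousAt).comp
      ((hTc.continuousAt hV).div_const _)).add continuousAt_const
  exact hcont.congr (Filter.mem_of_superset hV fun y hy => (hhT y hy).symm)

end SingularCoh

/-! ### Circle bundles -/

theorem UnitAddCircle.natCard_torsion {n : ℕ} (hn : 0 < n) :
    Nat.card {u : UnitAddCircle // n • u = 0} = n := by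
  have h : ∀ u : UnitAddCircle, n • u = 0 ↔
      u ∈ AddSubgroup.zmultiples (((1 : ℝ) / n : ℝ) : UnitAddCircle) := by
    intro u
    constructor
    · intro hu
      obtain ⟨m, -, rfl⟩ := (AddCircle.nsmul_eq_zero_iff hn).1 hu
      refine ⟨m, ?_⟩
      simp only [natCast_zsmul]
      rw [← AddCircle.coe_nsmul, nsmul_eq_mul, mul_one_div, mul_one]
    · rintro ⟨k, rfl⟩
      have := addOrderOf_nsmul_eq_zero (((1 : ℝ) / n : ℝ) : UnitAddCircle)
      rw [AddCircle.addOrderOf_period_div hn] at this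
      change n • k • (((1 : ℝ) / n : ℝ) : UnitAddCircle) = 0
      rw [smul_comm, this, smul_zero]
  rw [Nat.card_congr (Equiv.subtypeEquivRight h)]
  exact (Nat.card_zmultiples _).trans (AddCircle.addOrderOf_period_div hn)

namespace IsCircleBundle

variable {Q M : Type*} [TopologicalSpace Q] [TopologicalSpace M] [AddAction UnitAddCircle Q]
  {π : Q → M}

/-- The circle acts freely on the total space. -/
theorem vadd_right_cancel (hπ : IsCircleBundle π) {a b : UnitAddCircle} {q : Q}
    (h : a +ᵥ q = b +ᵥ q) : a = b := by
  obtain ⟨e, hq, he⟩ := hπ.exists_trivialization (π q)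
  have h' := congrArg (fun z => (e z).2) h
  simp only [he _ _ hq] at h'
  exact add_right_cancel h'

/-- Translating by the difference of the angular coordinates moves `q` to `q'`. -/
theorem sub_vadd_eq (hπ : IsCircleBundle π) {e : Bundle.Trivialization UnitAddCircle π}
    (he : ∀ (θ : UnitAddCircle) (q : Q), π q ∈ e.baseSet → (e (θ +ᵥ q)).2 = θ + (e q).2)
    {q q' : Q} (hq : π q ∈ e.baseSet) (hqq : π q' = π q) :
    ((e q').2 - (e q).2) +ᵥ q = q' := by
  have m1 : ((e q').2 - (e q).2) +ᵥ q ∈ e.source := by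
    rwa [e.mem_source, hπ.proj_vadd]
  have m2 : q' ∈ e.source := by
    rwa [e.mem_source, hqq]
  refine e.injOn m1 m2 (Prod.ext ?_ ?_)
  · exact (e.coe_fst m1).trans ((hπ.proj_vadd _ _).trans (hqq.symm.trans (e.coe_fst m2).symm))
  · exact (he _ _ hq).trans (sub_add_cancel _ _)

/-- The circle acts transitively on the fibers. -/
theorem exists_vadd_eq (hπ : IsCircleBundle π) {q q' : Q} (h : π q' = π q) :
    ∃ θ : UnitAddCircle, θ +ᵥ q = q' := by
  obtain ⟨e, hq, he⟩ := hπ.exists_trivialization (π q)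
  exact ⟨_, hπ.sub_vadd_eq he hq h⟩

theorem continuous_proj (hπ : IsCircleBundle π) : Continuous π :=
  continuous_iff_continuousAt.2 fun q => by
    obtain ⟨e, hq, -⟩ := hπ.exists_trivialization (π q)
    exact e.continuousAt_proj (e.mem_source.2 hq)

/-- The action, which is only assumed to be an action of the abstract group, is jointly continuous
because it is so in equivariant trivializations. -/
theorem continuous_vadd (hπ : IsCircleBundle π) :
    Continuous fun p : UnitAddCircle × Q => p.1 +ᵥ p.2 := by
  refine continuous_iff_continuousAt.2 fun ⟨θ, q⟩ => ?_
  obtain ⟨e, hq, he⟩ := hπ.exists_trivialization (π q)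
  have hmem : ((π q, θ + (e q).2) : M × UnitAddCircle) ∈ e.target := e.mem_target.2 hq
  have h1 : ContinuousAt (fun p : UnitAddCircle × Q => (π p.2, p.1 + (e p.2).2)) (θ, q) := by
    refine (hπ.continuous_proj.comp continuous_snd).continuousAt.prodMk
      (continuousAt_fst.add ?_)
    exact ((e.continuousAt (e.mem_source.2 hq)).comp
      (f := (Prod.snd : UnitAddCircle × Q → Q)) (x := (θ, q)) continuousAt_snd).snd
  have h2 := ContinuousAt.comp (f := fun p : UnitAddCircle × Q => (π p.2, p.1 + (e p.2).2))
    (x := (θ, q)) (e.toOpenPartialHomeomorph.continuousAt_symm hmem) h1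
  refine h2.congr ?_
  have hU : ∀ᶠ p : UnitAddCircle × Q in nhds (θ, q), π p.2 ∈ e.baseSet :=
    (hπ.continuous_proj.comp continuous_snd).continuousAt (e.open_baseSet.mem_nhds hq)
  filter_upwards [hU] with p hp
  have hs : p.1 +ᵥ p.2 ∈ e.source := by rwa [e.mem_source, hπ.proj_vadd]
  have h3 := e.toOpenPartialHomeomorph.left_inv hs
  have h4 : e (p.1 +ᵥ p.2) = (π p.2, p.1 + (e p.2).2) :=
    Prod.ext ((e.coe_fst hs).trans (hπ.proj_vadd _ _)) (he _ _ hp)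
  rw [← h3]
  exact congrArg e.toOpenPartialHomeomorph.symm h4.symm

/-- The gauge transformation `q ↦ h(π q) · q` of a circle bundle given by a map `h : M → S¹`. -/
noncomputable def gauge (hπ : IsCircleBundle π) (h : C(M, UnitAddCircle)) : Q ≃ₜ Q where
  toFun q := h (π q) +ᵥ q
  invFun q := -h (π q) +ᵥ q
  left_inv q := by simp only [hπ.proj_vadd, neg_vadd_vadd]
  right_inv q := by simp only [hπ.proj_vadd, vadd_neg_vadd]
  continuous_toFun :=
    hπ.continuous_vadd.comp ((h.continuous.comp hπ.continuous_proj).prodMk continuous_id)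
  continuous_invFun :=
    hπ.continuous_vadd.comp ((h.continuous.comp hπ.continuous_proj).neg.prodMk continuous_id)

end IsCircleBundle

/-! ### Isomorphisms of fiberwise coverings -/

namespace IsNFoldFiberwiseCovering

variable {Q P M : Type*} [TopologicalSpace Q] [TopologicalSpace P] [TopologicalSpace M]
  [AddAction UnitAddCircle Q] [AddAction UnitAddCircle P] {πQ : Q → M} {πP : P → M}

theorem natCard_fiber (hQ : IsCircleBundle πQ) (hP : IsCircleBundle πP) {n : ℕ} {φ : Q → P}
    (hφ : IsNFoldFiberwiseCovering πQ πP n φ) (q : Q) : Nat.card {z // φ z = φ q} = n := by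
  refine Eq.trans (Nat.card_congr (Equiv.ofBijective
    (fun u : {u : UnitAddCircle // n • u = 0} =>
      (⟨u.1 +ᵥ q, by rw [hφ.map_vadd, u.2, zero_vadd]⟩ : {z // φ z = φ q})) ⟨?_, ?_⟩)).symm
    (UnitAddCircle.natCard_torsion hφ.pos)
  · intro u v huv
    exact Subtype.ext (hQ.vadd_right_cancel (congrArg Subtype.val huv))
  · rintro ⟨z, hz⟩
    obtain ⟨θ, rfl⟩ := hQ.exists_vadd_eq (q := q) (q' := z) (by
      rw [← hφ.proj_comp, hz, hφ.proj_comp])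
    rw [hφ.map_vadd] at hz
    exact ⟨⟨θ, hP.vadd_right_cancel (hz.trans (zero_vadd _ _).symm)⟩, rfl⟩

theorem sheets_eq [Nonempty Q] (hQ : IsCircleBundle πQ) (hP : IsCircleBundle πP) {n₁ n₂ : ℕ}
    {φ₁ φ₂ : Q → P} (h₁ : IsNFoldFiberwiseCovering πQ πP n₁ φ₁)
    (h₂ : IsNFoldFiberwiseCovering πQ πP n₂ φ₂) (h : AreIsomorphicCoverings φ₁ φ₂) :
    n₁ = n₂ := by
  obtain ⟨ψ, rfl⟩ := h
  obtain ⟨q⟩ := ‹Nonempty Q›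
  rw [← h₁.natCard_fiber hQ hP (ψ q), ← h₂.natCard_fiber hQ hP q]
  exact (Nat.card_congr (ψ.toEquiv.subtypeEquiv fun _ => Iff.rfl)).symm

/-- A map of total spaces that intertwines two fiberwise coverings is automatically equivariant:
along an orbit, the failure of equivariance is a continuous function from the circle to the
finite group of `n`-torsion points, hence constant. -/
theorem map_vadd_of_comp_eq (hQ : IsCircleBundle πQ) (hP : IsCircleBundle πP) {n : ℕ}
    {φ₁ φ₂ : Q → P} (h₁ : IsNFoldFiberwiseCovering πQ πP n φ₁)
    (h₂ : IsNFoldFiberwiseCovering πQ πP n φ₂) {ψ : Q → Q} (hψ : Continuous ψ)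
    (h : φ₁ ∘ ψ = φ₂) (θ : UnitAddCircle) (q : Q) : ψ (θ +ᵥ q) = θ +ᵥ ψ q := by
  have hproj : ∀ z, πQ (ψ z) = πQ z := fun z => by
    rw [← h₁.proj_comp, ← h₂.proj_comp z, ← h, Function.comp_apply]
  obtain ⟨e, hq, he⟩ := hQ.exists_trivialization (πQ q)
  have hfib : ∀ t : UnitAddCircle, πQ (ψ (t +ᵥ q)) = πQ q := fun t => by
    rw [hproj, hQ.proj_vadd]
  let u : UnitAddCircle → UnitAddCircle := fun t => (e (ψ (t +ᵥ q))).2 - (e q).2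
  have hu : ∀ t, u t +ᵥ q = ψ (t +ᵥ q) := fun t => hQ.sub_vadd_eq he hq (hfib t)
  have hucont : Continuous u := by
    have hs : ∀ t, ψ (t +ᵥ q) ∈ e.source := fun t => by rwa [e.mem_source, hfib]
    have hc : Continuous fun t : UnitAddCircle => ψ (t +ᵥ q) :=
      hψ.comp (hQ.continuous_vadd.comp (continuous_id.prodMk continuous_const))
    exact (e.continuousOn_toFun.comp_continuous hc hs).snd.sub continuous_const
  -- the failure of equivariance of `ψ` along the orbit of `q`, an `n`-torsion point for each `t`
  let w : UnitAddCircle → UnitAddCircle := fun t => u t - t - u 0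
  have hw : ∀ t, n • w t = 0 := by
    intro t
    have h3 : ∀ s, n • u s +ᵥ φ₁ q = n • s +ᵥ φ₂ q := fun s => by
      rw [← h₁.map_vadd, hu, ← h₂.map_vadd, ← h, Function.comp_apply]
    have h4 : n • u t = n • t + n • u 0 := by
      refine hP.vadd_right_cancel (q := φ₁ q) ?_
      rw [h3 t, ← vadd_vadd, h3 0, smul_zero, zero_vadd]
    simp only [w, smul_sub, h4]
    abel
  have hwc : IsPreconnected (Set.range w) :=
    isPreconnected_range ((hucont.sub continuous_id).sub continuous_const)
  have hsub : (Set.range w).Subsingleton := by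
    by_contra hne
    exact hwc.infinite_of_nontrivial (Set.not_subsingleton_iff.1 hne)
      ((AddCircle.finite_torsion (1 : ℝ) h₁.pos).subset (Set.range_subset_iff.2 hw))
  have hw0 : w θ = 0 :=
    (hsub (Set.mem_range_self θ) (Set.mem_range_self 0)).trans (by simp [w])
  have huθ : u θ = θ + u 0 := by
    exact sub_eq_zero.1 ((sub_sub _ _ _).symm.trans hw0)
  rw [← hu, huθ, ← vadd_vadd, hu, zero_vadd]

theorem areIsomorphicCoverings_iff_exists_nsmul (hQ : IsCircleBundle πQ) (hP : IsCircleBundle πP)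
    {n : ℕ} {φ₁ φ₂ : Q → P} (h₁ : IsNFoldFiberwiseCovering πQ πP n φ₁)
    (h₂ : IsNFoldFiberwiseCovering πQ πP n φ₂) :
    AreIsomorphicCoverings φ₁ φ₂ ↔
      ∃ h : C(M, UnitAddCircle), ∀ x, n • h x = differenceMap hQ hP h₁ h₂ x := by
  constructor
  · rintro ⟨ψ, hψ⟩
    -- `ψ` and `id` are `1`-fold coverings of `Q` by itself, and their difference map is the
    -- required `n`-th part
    have hid : IsNFoldFiberwiseCovering πQ πQ 1 (id : Q → Q) :=
      ⟨one_pos, continuous_id, fun _ => rfl, fun θ q => by simp⟩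
    have hψ1 : IsNFoldFiberwiseCovering πQ πQ 1 ψ :=
      ⟨one_pos, ψ.continuous, fun q => by
        rw [← h₁.proj_comp, ← h₂.proj_comp q, ← hψ, Function.comp_apply], fun θ q => by
        rw [one_smul, map_vadd_of_comp_eq hQ hP h₁ h₂ ψ.continuous hψ]⟩
    refine ⟨differenceMap hQ hQ hid hψ1, fun x => ?_⟩
    obtain ⟨e, hx, -⟩ := hQ.exists_trivialization x
    obtain ⟨q, rfl⟩ : ∃ q, πQ q = x :=
      ⟨e.toOpenPartialHomeomorph.symm (x, 0), e.proj_symm_apply' hx⟩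
    refine hP.vadd_right_cancel (q := φ₁ q) ?_
    have hq : differenceMap hQ hQ hid hψ1 (πQ q) +ᵥ q = ψ q := differenceMap_vadd hQ hQ hid hψ1 q
    rw [← h₁.map_vadd, hq, differenceMap_vadd, ← hψ, Function.comp_apply]
  · rintro ⟨h, hh⟩
    refine ⟨hQ.gauge h, funext fun q => ?_⟩
    change φ₁ (h (πQ q) +ᵥ q) = φ₂ q
    rw [h₁.map_vadd, hh, differenceMap_vadd]

end IsNFoldFiberwiseCovering

theorem proposition3p5 {Q P M : Type*} [TopologicalSpace Q] [TopologicalSpace P]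
    [TopologicalSpace M] (m : ℕ) [ChartedSpace (EuclideanSpace ℝ (Fin m)) M]
    [CompactSpace M] [T2Space M]
    [AddAction UnitAddCircle Q] [AddAction UnitAddCircle P]
    (πQ : Q → M) (πP : P → M) (hQ : IsCircleBundle πQ) (hP : IsCircleBundle πP)
    (φ₁ φ₂ : Q → P) (hφ₁ : IsFiberwiseCovering πQ πP φ₁) (hφ₂ : IsFiberwiseCovering πQ πP φ₂) :
    AreIsomorphicCoverings φ₁ φ₂ ↔
      ∃ (n : ℕ) (h₁ : IsNFoldFiberwiseCovering πQ πP n φ₁)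
        (h₂ : IsNFoldFiberwiseCovering πQ πP n φ₂),
        SingularCoh.reduceMod M n (horizontalDistance hQ hP h₁ h₂) = 0 := by
  have : LocallyPathConnectedSpace M :=
    ChartedSpace.locallyPathConnectedSpace (EuclideanSpace ℝ (Fin m)) M
  constructor
  · intro h
    obtain ⟨n, h₁⟩ := hφ₁
    obtain ⟨n₂, h₂'⟩ := hφ₂
    have h₂ : IsNFoldFiberwiseCovering πQ πP n φ₂ := by
      rcases isEmpty_or_nonempty Q with hE | hE
      -- over the empty manifold the number of sheets is not determined, and any `n` serves
      · exact ⟨h₁.pos, h₂'.continuous, fun q => isEmptyElim q, fun _ q => isEmptyElim q⟩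
      · rwa [h₁.sheets_eq hQ hP h₂' h]
    obtain ⟨g, hg⟩ := (h₁.areIsomorphicCoverings_iff_exists_nsmul hQ hP h₂).1 h
    exact ⟨n, h₁, h₂, SingularCoh.reduceMod_pullback_fundamentalClass_eq_zero hg⟩
  · rintro ⟨n, h₁, h₂, h⟩
    exact (h₁.areIsomorphicCoverings_iff_exists_nsmul hQ hP h₂).2
      (SingularCoh.exists_nsmul_eq_of_reduceMod_eq_zero h₁.pos _ h)
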